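/- Let $m\ge 1$ and $\mathbb T^m=\mathbb R^m/2\pi\mathbb Z^m$. Functions on $\mathbb T^m$ are identified with functions on $\mathbb R^m$ that are $2\pi$-periodic in each variable. For an integrable function $f$ on $\mathbb T^m$ put $$\widehat f(k)=\frac1{(2\pi)^m}\int_{[0,2\pi]^m} f(t)e^{-i(k,t)}\,dt,\qquad k\in\mathbb Z^m.$$ For $1<p<2$ let $A_p(\mathbb T^m)$ be the space of integrable functions $f$ on $\mathbb T^m$ with $\widehat f\in \ell^p(\mathbb Z^m)$, and let $A(\mathbb T^m)=A_1(\mathbb T^m)$ be the space of continuous functions $f$ on $\mathbb T^m$ with $\widehat f\in\ell^1(\mathbb Z^m)$; put $$\|f\|_{A_p(\mathbb T^m)}=\Big(\sum_{k\in\mathbb Z^m}|\widehat f(k)|^p\Big)^{1/p}.$$ For a real function $\varphi$ on $\mathbb T^m$ let $\Lambda(\varphi,p)$ be the set of all $\lambda\in\mathbb R$ such that $e^{i\lambda\varphi}\in A_p(\mathbb T^m)$. Let $\varphi\in C^{1,1}(\mathbb T^m)$ be a real function, that is, $\varphi$ is $2\pi$-periodic in each variable and differentiable, and every partial derivative $g=\partial\varphi/\partial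 t_j$ satisfies $$\sup_{|t_1-t_2|\le\delta}|g(t_1)-g(t_2)|=O(\delta),\qquad \delta\to+0.$$ Suppose that the gradient of $\varphi$ is nondegenerate, that is, the set $\nabla\varphi(\mathbb T^m)\subset\mathbb R^m$ has positive Lebesgue measure. Then for every $p$ with $1\le p<2$ there is a constant $c_p=c(p,\varphi)>0$, independent of $\lambda$, such that $$\|e^{i\lambda\varphi}\|_{A_p(\mathbb T^m)}\ge c_p\,|\lambda|^{m\left(\frac1p-\frac12\right)}\qquad\text{for all }\lambda\in\Lambda(\varphi,p).$$ In particular, there is a constant $c=c(\varphi)>0$ such that $\|e^{i\lambda\varphi}\|_{A(\mathbb T^m)}\ge c\,|\lambda|^{m/2}$ for all $\lambda\in\Lambda(\varphi,1)$. -/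

import Mathlib

open scoped ENNReal

noncomputable section

namespace TorusA

/-- `f` is `2π`-periodic with respect to each variable, i.e. it is a function on the torus
`𝕋^m = ℝ^m / 2πℤ^m`. -/
def IsTorusFunction {m : ℕ} {F : Type*} (f : EuclideanSpace ℝ (Fin m) → F) : Prop :=
  ∀ j : Fin m, Function.Periodic f (EuclideanSpace.single j (2 * Real.pi))

/-- The modulus of continuity `ω(g, δ) = sup {|g t₁ - g t₂| : |t₁ - t₂| ≤ δ}` of a function on
`ℝ^m` (a value in `[0, ∞]`). -/
def modulusOfContinuity {m : ℕ} {F : Type*} [NormedAddCommGroup F]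
    (g : EuclideanSpace ℝ (Fin m) → F) (δ : ℝ) : ℝ≥0∞ :=
  ⨆ (t₁ : EuclideanSpace ℝ (Fin m)) (t₂ : EuclideanSpace ℝ (Fin m)) (_ : ‖t₁ - t₂‖ ≤ δ),
    ENNReal.ofReal ‖g t₁ - g t₂‖

/-- The Lipschitz condition of order `α`: `ω(g, δ) = O(δ ^ α)` as `δ → +0`. -/
def IsLip {m : ℕ} {F : Type*} [NormedAddCommGroup F] (α : ℝ)
    (g : EuclideanSpace ℝ (Fin m) → F) : Prop :=
  ∃ C : ℝ, ∀ᶠ δ in nhdsWithin (0 : ℝ) (Set.Ioi 0),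
    modulusOfContinuity g δ ≤ ENNReal.ofReal (C * δ ^ α)

/-- The class `C^{1,α}(𝕋^m)` of real functions: `2π`-periodic in each variable, differentiable,
and with all first order partial derivatives satisfying the Lipschitz condition of order `α`. -/
structure IsC1Lip {m : ℕ} (α : ℝ) (φ : EuclideanSpace ℝ (Fin m) → ℝ) : Prop where
  periodic : IsTorusFunction φ
  differentiable : Differentiable ℝ φ
  lip_partial : ∀ j : Fin m, IsLip α (fun t => fderiv ℝ φ t (EuclideanSpace.single j 1))

/-- The gradient of `φ` is nondegenerate: its range has positive Lebesgue measure. -/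
def NondegenerateGradient {m : ℕ} (φ : EuclideanSpace ℝ (Fin m) → ℝ) : Prop :=
  0 < MeasureTheory.volume (Set.range (gradient φ))

/-- The cube `[0, 2π]^m`. -/
def cube (m : ℕ) : Set (EuclideanSpace ℝ (Fin m)) :=
  {t | ∀ j : Fin m, t j ∈ Set.Icc 0 (2 * Real.pi)}

/-- The Fourier coefficient `(2π)^{-m} ∫ f(t) e^{-i(k,t)} dt` over the torus, `k ∈ ℤ^m`. -/
def fourierCoefficient {m : ℕ} (f : EuclideanSpace ℝ (Fin m) → ℂ) (k : Fin m → ℤ) : ℂ :=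
  (1 / (2 * (Real.pi : ℂ)) ^ m) *
    ∫ t in cube m, f t * Complex.exp (-(Complex.I * ((∑ j, (k j : ℝ) * t j : ℝ) : ℂ)))

/-- Membership in `A_p(𝕋^m)`: an integrable (for `p = 1`: continuous) function on the torus whose
sequence of Fourier coefficients belongs to `ℓ^p(ℤ^m)`. -/
structure MemA {m : ℕ} (p : ℝ) (f : EuclideanSpace ℝ (Fin m) → ℂ) : Prop where
  periodic : IsTorusFunction f
  integrable : MeasureTheory.IntegrableOn f (cube m) MeasureTheory.volume
  continuous : p = 1 → Continuous f
  summable : Summable (fun k : Fin m → ℤ => ‖fourierCoefficient f k‖ ^ p)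

/-- The norm `‖f‖_{A_p(𝕋^m)} = (∑ |f̂(k)|^p)^{1/p}` (meaningful for `f ∈ A_p(𝕋^m)`). -/
def normA {m : ℕ} (p : ℝ) (f : EuclideanSpace ℝ (Fin m) → ℂ) : ℝ :=
  (∑' k : Fin m → ℤ, ‖fourierCoefficient f k‖ ^ p) ^ (1 / p)

/-- The function `e^{iλφ}`. -/
def expPhase {m : ℕ} (l : ℝ) (φ : EuclideanSpace ℝ (Fin m) → ℝ) :
    EuclideanSpace ℝ (Fin m) → ℂ :=
  fun t => Complex.exp (Complex.I * (l : ℂ) * (φ t : ℂ))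

/-- The set `Λ(φ, p)` of all real `λ` with `e^{iλφ} ∈ A_p(𝕋^m)`. -/
def frequencySet {m : ℕ} (φ : EuclideanSpace ℝ (Fin m) → ℝ) (p : ℝ) : Set ℝ :=
  {l | MemA p (expPhase l φ)}

end TorusA

end

namespace TorusA

open MeasureTheory
open scoped Pointwise

/-! If an integer vector `k` lies near `λ∇φ(a)`, the phase `λφ(t) - (k,t)` is almost stationary at
`a`. Since `∇φ` is Lipschitz, the phase varies little on a ball of radius about `|λ|^(-1/2)`.
Testing `e^{iλφ}e^{-i(k,t)}` against a nonnegative bump of that width around `a` therefore gives at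
least half the mass of the bump, of order `|λ|^(-m/2)`
(`half_le_norm_integral_demodulated_mul_cosKernel`).

The bump is the trigonometric polynomial `∏ cos²ⁿ((t_j - a_j)/2)` with `n` of order `|λ|`. Its
Fourier coefficients have moduli summing to 1, so the test integral is at most `(2π)^m` times an
average of `|f̂|` over translates of `k`, where `f = e^{iλφ}` (`norm_integral_mul_cosKernel_le`).
The weights of the average depend neither on `k` nor on `a`.

A set of positive measure dilated by `λ` meets at least a constant times `|λ|^m` unit lattice cells
(`exists_finset_floor_smul`), which supplies that many such `k`. Convolution with a probability
vector does not increase the `ℓ^p` norm (`card_mul_rpow_le_tsum`), so the norm is at least a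
constant times `|λ|^(m/p) |λ|^(-m/2)`. -/

/-! ### Powers of the raised cosine and their integrals. -/

/-- The trigonometric polynomial `(1 + cos x) / 2 = cos² (x / 2)`. -/
noncomputable def raisedCos (x : ℝ) : ℝ := (1 + Real.cos x) / 2

lemma raisedCos_eq_sq (x : ℝ) : raisedCos x = Real.cos (x / 2) ^ 2 := by
  rw [raisedCos, Real.cos_sq]
  ring_nf

lemma raisedCos_nonneg (x : ℝ) : 0 ≤ raisedCos x := by
  rw [raisedCos_eq_sq]; positivity

@[fun_prop]
lemma continuous_raisedCos : Continuous raisedCos := by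
  unfold raisedCos; fun_prop

lemma raisedCos_periodic : Function.Periodic raisedCos (2 * Real.pi) := fun x => by
  simp [raisedCos]

/-- The integral of a power of `raisedCos` over a period. -/
noncomputable def raisedCosIntegral (n : ℕ) : ℝ :=
  ∫ x in (0 : ℝ)..(2 * Real.pi), raisedCos x ^ n

lemma raisedCosIntegral_eq (n : ℕ) :
    raisedCosIntegral n = 2 * ∫ x in (0 : ℝ)..Real.pi, Real.cos x ^ (2 * n) := by
  have := intervalIntegral.integral_comp_div (a := 0) (b := 2 * Real.pi)
    (fun x : ℝ => Real.cos x ^ (2 * n)) (c := 2) (by norm_num)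
  simp only [raisedCosIntegral, raisedCos_eq_sq, ← pow_mul, this, zero_div, smul_eq_mul]
  rw [mul_div_cancel_left₀ _ (by norm_num : (2 : ℝ) ≠ 0)]

lemma raisedCosIntegral_zero : raisedCosIntegral 0 = 2 * Real.pi := by
  simp [raisedCosIntegral]

lemma raisedCosIntegral_succ (n : ℕ) :
    raisedCosIntegral (n + 1) = (2 * n + 1) / (2 * n + 2) * raisedCosIntegral n := by
  rw [raisedCosIntegral_eq, raisedCosIntegral_eq, show 2 * (n + 1) = 2 * n + 2 by ring,
    integral_cos_pow]
  simp
  ring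

lemma raisedCosIntegral_pos (n : ℕ) : 0 < raisedCosIntegral n := by
  induction n with
  | zero => rw [raisedCosIntegral_zero]; positivity
  | succ n ih => rw [raisedCosIntegral_succ]; positivity

/-- The right side equals 1 at `n = 1`, and by the Wallis recursion it grows by the factor `(2n+1)²
/ (4n(n+1)) ≥ 1` at each step. This bounds the mass of the bump from below by a multiple of
`n^(-1/2)`. -/
lemma one_le_mul_raisedCosIntegral_sq {n : ℕ} (hn : 1 ≤ n) :
    1 ≤ 4 * n * (raisedCosIntegral n / (2 * Real.pi)) ^ 2 := by
  induction n, hn using Nat.le_induction with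
  | base =>
    rw [raisedCosIntegral_succ, raisedCosIntegral_zero]
    field_simp
    norm_num
  | succ n hn ih =>
    refine ih.trans ?_
    rw [raisedCosIntegral_succ, mul_div_assoc, mul_pow, ← mul_assoc]
    refine mul_le_mul_of_nonneg_right ?_ (sq_nonneg _)
    rw [div_pow, mul_div_assoc', le_div_iff₀ (by positivity)]
    push_cast
    nlinarith [Nat.cast_nonneg (α := ℝ) n]

lemma integral_raisedCos_sub_pow (n : ℕ) (a : ℝ) :
    ∫ x in Set.Icc 0 (2 * Real.pi), raisedCos (x - a) ^ n = raisedCosIntegral n := by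
  have hp : Function.Periodic (fun x => raisedCos x ^ n) (2 * Real.pi) := fun x => by
    simp only [raisedCos_periodic x]
  rw [integral_Icc_eq_integral_Ioc, ← intervalIntegral.integral_of_le (by positivity),
    intervalIntegral.integral_comp_sub_right (fun x => raisedCos x ^ n), raisedCosIntegral]
  have := hp.intervalIntegral_add_eq (0 - a) 0
  rw [zero_add] at this
  rw [← this]
  congr 1
  ring

/-! ### The product kernel on the cube: mass and concentration. -/

lemma cube_eq_preimage (m : ℕ) :
    cube m = (MeasurableEquiv.toLp 2 (Fin m → ℝ)).symm ⁻¹'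
      Set.univ.pi (fun _ => Set.Icc 0 (2 * Real.pi)) := by
  ext t
  rw [Set.mem_preimage, Set.mem_univ_pi]
  rfl

lemma isCompact_cube (m : ℕ) : IsCompact (cube m) := by
  have : cube m = (PiLp.continuousLinearEquiv 2 ℝ (fun _ : Fin m => ℝ)).symm ''
      Set.univ.pi (fun _ => Set.Icc 0 (2 * Real.pi)) := by
    rw [ContinuousLinearEquiv.image_symm_eq_preimage]
    ext t
    rw [Set.mem_preimage, Set.mem_univ_pi]
    rfl
  rw [this]
  exact (isCompact_univ_pi fun _ => isCompact_Icc).image (ContinuousLinearEquiv.continuous _)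

lemma setIntegral_cube_prod {m : ℕ} (h : Fin m → ℝ → ℝ) :
    ∫ t in cube m, ∏ j, h j (t j) = ∏ j, ∫ x in Set.Icc 0 (2 * Real.pi), h j x := by
  have := (EuclideanSpace.volume_preserving_symm_measurableEquiv_toLp (Fin m)).setIntegral_preimage_emb
    (MeasurableEquiv.measurableEmbedding _) (fun x => ∏ j, h j (x j))
    (Set.univ.pi (fun _ => Set.Icc 0 (2 * Real.pi)))
  rw [← cube_eq_preimage] at this
  rw [← integral_fintype_prod_eq_prod, ← Measure.restrict_pi_pi]
  exact this

/-- The product of the `n`-th powers of `raisedCos` in the coordinates of `t - a`. -/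
noncomputable def cosKernel {m : ℕ} (n : ℕ) (a t : EuclideanSpace ℝ (Fin m)) : ℝ :=
  ∏ j, raisedCos (t j - a j) ^ n

lemma cosKernel_nonneg {m : ℕ} (n : ℕ) (a t : EuclideanSpace ℝ (Fin m)) : 0 ≤ cosKernel n a t :=
  Finset.prod_nonneg fun _ _ => pow_nonneg (raisedCos_nonneg _) _

@[fun_prop]
lemma continuous_cosKernel {m : ℕ} (n : ℕ) (a : EuclideanSpace ℝ (Fin m)) :
    Continuous (cosKernel n a) := by
  unfold cosKernel; fun_prop

lemma integral_cosKernel {m : ℕ} (n : ℕ) (a : EuclideanSpace ℝ (Fin m)) :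
    ∫ t in cube m, cosKernel n a t = raisedCosIntegral n ^ m := by
  unfold cosKernel
  rw [setIntegral_cube_prod (fun j x => raisedCos (x - a j) ^ n)]
  simp [integral_raisedCos_sub_pow]

/-- The factor `1 - raisedCos x = sin²(x/2)` is a periodic substitute for squared distance. Its mean
`1/(2n+2)` under the kernel, read off from the Wallis recursion, expresses concentration at scale
`n^(-1/2)`. -/
lemma integral_one_sub_raisedCos_mul_cosKernel {m : ℕ} (n : ℕ) (a : EuclideanSpace ℝ (Fin m))
    (j : Fin m) :
    ∫ t in cube m, (1 - raisedCos (t j - a j)) * cosKernel n a t =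
      raisedCosIntegral n ^ m / (2 * n + 2) := by
  have key : ∀ t : EuclideanSpace ℝ (Fin m), (1 - raisedCos (t j - a j)) * cosKernel n a t =
      ∏ i, (fun x => (if i = j then 1 - raisedCos (x - a i) else 1) * raisedCos (x - a i) ^ n)
        (t i) := fun t => by
    simp only [cosKernel, Finset.prod_mul_distrib]
    simp
  have hI : ∀ i, ∫ x in Set.Icc 0 (2 * Real.pi),
      (if i = j then 1 - raisedCos (x - a i) else 1) * raisedCos (x - a i) ^ n =
      (if i = j then (1 / (2 * n + 2) : ℝ) else 1) * raisedCosIntegral n := fun i => by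
    split_ifs with h
    · have : ∀ x, (1 - raisedCos (x - a i)) * raisedCos (x - a i) ^ n =
          raisedCos (x - a i) ^ n - raisedCos (x - a i) ^ (n + 1) := fun x => by ring
      simp only [this]
      have hi : ∀ k, IntegrableOn (fun x => raisedCos (x - a i) ^ k)
          (Set.Icc 0 (2 * Real.pi)) := fun k =>
        ContinuousOn.integrableOn_Icc (by fun_prop)
      rw [integral_sub (hi _) (hi _), integral_raisedCos_sub_pow, integral_raisedCos_sub_pow,
        raisedCosIntegral_succ]
      field_simp
      ring
    · simp [integral_raisedCos_sub_pow]
  simp only [key]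
  rw [setIntegral_cube_prod (fun i x =>
    (if i = j then 1 - raisedCos (x - a i) else 1) * raisedCos (x - a i) ^ n)]
  simp only [hI, Finset.prod_mul_distrib]
  simp
  ring

/-! ### Fourier expansion of the kernel and averaging of coefficients. -/

/-- The frequencies, with multiplicity, of `4 * raisedCos`. -/
def raisedCosFrequency : Fin 4 → ℤ := ![0, 0, 1, -1]

/-- The frequencies, with multiplicity, of a multiple of `cosKernel n`. -/
def cosKernelFrequency {m n : ℕ} (w : Fin m × Fin n → Fin 4) (j : Fin m) : ℤ :=
  ∑ i, raisedCosFrequency (w (j, i))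

lemma four_mul_raisedCos (x : ℝ) :
    4 * (raisedCos x : ℂ) = ∑ q, Complex.exp (Complex.I * (raisedCosFrequency q * x)) := by
  simp only [raisedCos, raisedCosFrequency, Fin.sum_univ_four]
  push_cast
  rw [Complex.cos]
  simp
  ring_nf

lemma four_pow_mul_cosKernel {m : ℕ} (n : ℕ) (a t : EuclideanSpace ℝ (Fin m)) :
    4 ^ (m * n) * (cosKernel n a t : ℂ) = ∑ w : Fin m × Fin n → Fin 4,
      Complex.exp (Complex.I * ((∑ j, (cosKernelFrequency w j : ℝ) * (t j - a j) : ℝ) : ℂ)) := by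
  calc 4 ^ (m * n) * (cosKernel n a t : ℂ)
      = ∏ x : Fin m × Fin n, 4 * (raisedCos (t x.1 - a x.1) : ℂ) := by
        rw [Fintype.prod_prod_type]
        simp only [cosKernel, Finset.prod_const, Finset.card_univ, Fintype.card_fin, mul_pow,
          Finset.prod_mul_distrib, ← pow_mul]
        push_cast
        rw [mul_comm n m]
    _ = ∑ w : Fin m × Fin n → Fin 4, ∏ x : Fin m × Fin n,
          Complex.exp (Complex.I * (raisedCosFrequency (w x) * (t x.1 - a x.1 : ℝ))) := by
        simp only [four_mul_raisedCos]
        rw [Finset.prod_univ_sum, Fintype.piFinset_univ]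
    _ = _ := by
        refine Finset.sum_congr rfl fun w _ => ?_
        rw [← Complex.exp_sum, Fintype.sum_prod_type]
        congr 1
        simp only [cosKernelFrequency, ← Finset.mul_sum, ← Finset.sum_mul]
        push_cast
        rfl

/-- Integrating against a modulated `cosKernel` averages Fourier coefficients. -/
lemma norm_integral_mul_cosKernel_le {m : ℕ} (n : ℕ) {f : EuclideanSpace ℝ (Fin m) → ℂ}
    (hf : Continuous f) (k : Fin m → ℤ) (a : EuclideanSpace ℝ (Fin m)) :
    ‖∫ t in cube m, f t * Complex.exp (-(Complex.I * ((∑ j, (k j : ℝ) * t j : ℝ) : ℂ))) *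
        (cosKernel n a t : ℂ)‖ ≤
      (2 * Real.pi) ^ m * ∑ w : Fin m × Fin n → Fin 4,
        (1 / 4 ^ (m * n) : ℝ) * ‖fourierCoefficient f (k - cosKernelFrequency w)‖ := by
  -- Centring the kernel at `a` only multiplies each of its `4^(mn)` equally weighted exponentials
  -- by a unimodular phase, which disappears in the norm.
  have key : ∀ t, f t * Complex.exp (-(Complex.I * ((∑ j, (k j : ℝ) * t j : ℝ) : ℂ))) *
        (cosKernel n a t : ℂ) = ∑ w : Fin m × Fin n → Fin 4,
      (1 / 4 ^ (m * n) *
        Complex.exp (-(Complex.I * ((∑ j, (cosKernelFrequency w j : ℝ) * a j : ℝ) : ℂ)))) *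
      (f t * Complex.exp (-(Complex.I *
        ((∑ j, (((k - cosKernelFrequency w) j : ℤ) : ℝ) * t j : ℝ) : ℂ)))) := fun t => by
    have h := four_pow_mul_cosKernel n a t
    rw [mul_comm, ← eq_div_iff (by simp)] at h
    rw [h, div_eq_mul_one_div, Finset.sum_mul, Finset.mul_sum]
    refine Finset.sum_congr rfl fun w _ => ?_
    have : Complex.exp (Complex.I *
        ((∑ j, (cosKernelFrequency w j : ℝ) * (t j - a j) : ℝ) : ℂ)) *
        Complex.exp (-(Complex.I * ((∑ j, (k j : ℝ) * t j : ℝ) : ℂ))) =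
        Complex.exp (-(Complex.I * ((∑ j, (cosKernelFrequency w j : ℝ) * a j : ℝ) : ℂ))) *
        Complex.exp (-(Complex.I *
          ((∑ j, (((k - cosKernelFrequency w) j : ℤ) : ℝ) * t j : ℝ) : ℂ))) := by
      rw [← Complex.exp_add, ← Complex.exp_add]
      congr 1
      simp only [mul_sub, sub_mul, Finset.sum_sub_distrib, Pi.sub_apply, Int.cast_sub]
      push_cast
      ring
    linear_combination (f t * (1 / 4 ^ (m * n))) * this
  simp only [key]
  rw [integral_finsetSum]
  · rw [Finset.mul_sum]
    refine (norm_sum_le _ _).trans (Finset.sum_le_sum fun w _ => ?_)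
    rw [integral_const_mul, norm_mul, norm_mul, fourierCoefficient, norm_mul,
      ← mul_neg, ← Complex.ofReal_neg, Complex.norm_exp_I_mul_ofReal]
    have hpi : (0 : ℝ) < Real.pi := Real.pi_pos
    simp only [norm_div, norm_pow, norm_mul, norm_one, Complex.norm_ofNat, Complex.norm_real,
      Real.norm_of_nonneg hpi.le]
    apply le_of_eq
    field_simp
  · intro w _
    refine (ContinuousOn.integrableOn_compact (isCompact_cube m) ?_)
    fun_prop

/-- A finite form of Young's inequality for convolution with a probability vector. -/
lemma card_mul_rpow_le_tsum {G ι : Type*} [AddCommGroup G] [Fintype ι] (α : ι → ℝ)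
    (hα : ∀ i, 0 ≤ α i) (hα1 : ∑ i, α i = 1) (v : ι → G) {g : G → ℝ} (hg : ∀ k, 0 ≤ g k)
    {p : ℝ} (hp : 1 ≤ p) (hs : Summable fun k => g k ^ p) (S : Finset G) {c : ℝ} (hc : 0 ≤ c)
    (h : ∀ k ∈ S, c ≤ ∑ i, α i * g (k - v i)) :
    S.card * c ^ p ≤ ∑' k, g k ^ p := by
  calc (S.card : ℝ) * c ^ p = ∑ k ∈ S, c ^ p := by simp
    _ ≤ ∑ k ∈ S, ∑ i, α i * g (k - v i) ^ p := by
        refine Finset.sum_le_sum fun k hk => ?_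
        refine (Real.rpow_le_rpow hc (h k hk) (by linarith)).trans ?_
        exact Real.rpow_arith_mean_le_arith_mean_rpow _ _ _ (fun i _ => hα i) hα1
          (fun i _ => hg _) hp
    _ = ∑ i, α i * ∑ k ∈ S, g (k - v i) ^ p := by
        rw [Finset.sum_comm]
        simp only [Finset.mul_sum]
    _ ≤ ∑ i, α i * ∑' k, g k ^ p := by
        refine Finset.sum_le_sum fun i _ => mul_le_mul_of_nonneg_left ?_ (hα i)
        rw [← (Equiv.subRight (v i)).tsum_eq]
        exact ((Equiv.subRight (v i)).summable_iff.mpr hs).sum_le_tsum S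
          (fun k _ => Real.rpow_nonneg (hg _) _)
    _ = _ := by rw [← Finset.sum_mul, hα1, one_mul]

/-! ### First-order Taylor estimate for a Lipschitz gradient. -/

lemma IsLip.exists_norm_sub_le {m : ℕ} {F : Type*} [NormedAddCommGroup F]
    {g : EuclideanSpace ℝ (Fin m) → F} (hg : IsLip 1 g) :
    ∃ C δ : ℝ, 0 ≤ C ∧ 0 < δ ∧ ∀ x y, ‖x - y‖ < δ → ‖g x - g y‖ ≤ C * ‖x - y‖ := by
  obtain ⟨C, hC⟩ := hg
  obtain ⟨δ, hδ, h⟩ := mem_nhdsGT_iff_exists_Ioo_subset.mp hC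
  refine ⟨max C 0, δ, le_max_right _ _, hδ, fun x y hxy => ?_⟩
  rcases (norm_nonneg (x - y)).eq_or_lt with h0 | h0
  · rw [sub_eq_zero.mp (norm_eq_zero.mp h0.symm)]
    simp
  · have h1 : modulusOfContinuity g ‖x - y‖ ≤ ENNReal.ofReal (C * ‖x - y‖ ^ (1 : ℝ)) := h ⟨h0, hxy⟩
    rw [Real.rpow_one] at h1
    have h2 : ENNReal.ofReal ‖g x - g y‖ ≤ ENNReal.ofReal (max C 0 * ‖x - y‖) := by
      refine le_trans ?_ (h1.trans (ENNReal.ofReal_le_ofReal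
        (mul_le_mul_of_nonneg_right (le_max_left _ _) h0.le)))
      exact le_iSup₂_of_le x y (le_iSup_of_le le_rfl le_rfl)
    exact (ENNReal.ofReal_le_ofReal_iff (by positivity)).mp h2

lemma apply_eq_sum_single {m : ℕ} (L : EuclideanSpace ℝ (Fin m) →L[ℝ] ℝ)
    (x : EuclideanSpace ℝ (Fin m)) : L x = ∑ j, L (EuclideanSpace.single j 1) * x j := by
  conv_lhs => rw [← (EuclideanSpace.basisFun (Fin m) ℝ).sum_repr x]
  simp [mul_comm]

lemma opNorm_le_sum_single {m : ℕ} (L : EuclideanSpace ℝ (Fin m) →L[ℝ] ℝ) :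
    ‖L‖ ≤ ∑ j, ‖L (EuclideanSpace.single j 1)‖ := by
  refine L.opNorm_le_bound (Finset.sum_nonneg fun _ _ => norm_nonneg _) fun x => ?_
  rw [apply_eq_sum_single L x, Finset.sum_mul]
  refine (norm_sum_le _ _).trans (Finset.sum_le_sum fun j _ => ?_)
  rw [norm_mul]
  exact mul_le_mul_of_nonneg_left (PiLp.norm_apply_le x j) (norm_nonneg _)

/-- Mean value inequality on the ball of radius `‖y - x‖` about `x`, where the derivative differs
from its value at `x` by at most `C * ‖y - x‖`. -/
lemma IsC1Lip.exists_abs_sub_fderiv_le {m : ℕ} {φ : EuclideanSpace ℝ (Fin m) → ℝ}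
    (hφ : IsC1Lip 1 φ) :
    ∃ C δ : ℝ, 0 ≤ C ∧ 0 < δ ∧ ∀ x y, ‖y - x‖ < δ →
      |φ y - φ x - fderiv ℝ φ x (y - x)| ≤ C * ‖y - x‖ ^ 2 := by
  choose C δ hC hδ h using fun j => (hφ.lip_partial j).exists_norm_sub_le
  obtain ⟨r, hr, hrδ⟩ : ∃ r > 0, ∀ j, r ≤ δ j := by
    rcases isEmpty_or_nonempty (Fin m) with he | he
    · exact ⟨1, one_pos, fun j => he.elim j⟩
    · obtain ⟨i, hi⟩ := Finite.exists_min δ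
      exact ⟨δ i, hδ i, hi⟩
  refine ⟨∑ j, C j, r, Finset.sum_nonneg fun j _ => hC j, hr, fun x y hxy => ?_⟩
  rw [sq, ← mul_assoc, ← Real.norm_eq_abs]
  refine Convex.norm_image_sub_le_of_norm_fderiv_le' (s := Metric.closedBall x ‖y - x‖)
    (fun z _ => hφ.differentiable z) (fun z hz => ?_) (convex_closedBall _ _)
    (Metric.mem_closedBall_self (norm_nonneg _)) (by simp [dist_eq_norm])
  rw [Metric.mem_closedBall, dist_eq_norm] at hz
  refine (opNorm_le_sum_single _).trans ?_
  rw [Finset.sum_mul]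
  refine Finset.sum_le_sum fun j _ => ?_
  exact (h j z x (hz.trans_lt (hxy.trans_le (hrδ j)))).trans
    (mul_le_mul_of_nonneg_left hz (hC j))

/-! ### Near-stationary phase after demodulation. -/

lemma IsTorusFunction.periodic_sum {m : ℕ} {F : Type*} {f : EuclideanSpace ℝ (Fin m) → F}
    (hf : IsTorusFunction f) (z : Fin m → ℤ) :
    Function.Periodic f (∑ j, z j • EuclideanSpace.single j (2 * Real.pi)) :=
  Finset.sum_induction _ (Function.Periodic f) (fun _ _ => Function.Periodic.add_period)
    (fun x => by simp) fun j _ => (hf j).zsmul (z j)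

lemma sq_le_one_sub_raisedCos {x : ℝ} (hx : |x| ≤ Real.pi) :
    x ^ 2 ≤ Real.pi ^ 2 * (1 - raisedCos x) := by
  have h := Real.cos_le_one_sub_mul_cos_sq hx
  have hpi := Real.pi_pos
  rw [raisedCos]
  have : 2 / Real.pi ^ 2 * x ^ 2 * Real.pi ^ 2 = 2 * x ^ 2 := by field_simp
  nlinarith [sq_pos_of_pos hpi]

/-- The function `e^{iλφ}` demodulated by the frequency `k`. -/
noncomputable def demodulated {m : ℕ} (l : ℝ) (φ : EuclideanSpace ℝ (Fin m) → ℝ) (k : Fin m → ℤ)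
    (t : EuclideanSpace ℝ (Fin m)) : ℂ :=
  expPhase l φ t * Complex.exp (-(Complex.I * ((∑ j, (k j : ℝ) * t j : ℝ) : ℂ)))

lemma demodulated_eq {m : ℕ} (l : ℝ) (φ : EuclideanSpace ℝ (Fin m) → ℝ) (k : Fin m → ℤ)
    (t : EuclideanSpace ℝ (Fin m)) :
    demodulated l φ k t = Complex.exp (Complex.I * ((l * φ t - ∑ j, (k j : ℝ) * t j : ℝ) : ℂ)) := by
  rw [demodulated, expPhase, ← Complex.exp_add]
  congr 1
  push_cast
  ring

lemma norm_demodulated {m : ℕ} (l : ℝ) (φ : EuclideanSpace ℝ (Fin m) → ℝ) (k : Fin m → ℤ)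
    (t : EuclideanSpace ℝ (Fin m)) : ‖demodulated l φ k t‖ = 1 := by
  rw [demodulated_eq, Complex.norm_exp_I_mul_ofReal]

lemma isTorusFunction_demodulated {m : ℕ} (l : ℝ) {φ : EuclideanSpace ℝ (Fin m) → ℝ}
    (hφ : IsTorusFunction φ) (k : Fin m → ℤ) : IsTorusFunction (demodulated l φ k) := by
  intro j t
  have h : ∑ i, (k i : ℝ) * (t + EuclideanSpace.single j (2 * Real.pi)) i =
      (∑ i, (k i : ℝ) * t i) + k j * (2 * Real.pi) := by
    simp [mul_add, Finset.sum_add_distrib]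
  rw [demodulated_eq, demodulated_eq, hφ j t, h, Complex.exp_eq_exp_iff_exists_int]
  refine ⟨-k j, ?_⟩
  push_cast
  ring

lemma norm_demodulated_sub_le {m : ℕ} (l : ℝ) (φ : EuclideanSpace ℝ (Fin m) → ℝ) (k : Fin m → ℤ)
    (s t : EuclideanSpace ℝ (Fin m)) :
    ‖demodulated l φ k s - demodulated l φ k t‖ ≤
      |(l * φ s - ∑ j, (k j : ℝ) * s j) - (l * φ t - ∑ j, (k j : ℝ) * t j)| := by
  set x := l * φ s - ∑ j, (k j : ℝ) * s j with hx
  set y := l * φ t - ∑ j, (k j : ℝ) * t j with hy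
  have : demodulated l φ k s - demodulated l φ k t =
      demodulated l φ k t * (Complex.exp (Complex.I * ((x - y : ℝ) : ℂ)) - 1) := by
    rw [demodulated_eq, demodulated_eq, ← hx, ← hy, mul_sub, ← Complex.exp_add]
    push_cast
    ring_nf
  rw [this, norm_mul, norm_demodulated, one_mul]
  exact Real.norm_exp_I_mul_ofReal_sub_one_le

/-- Near a point whose scaled gradient is within distance one of `k` in each coordinate,
the demodulated function is almost constant at the scale `(1 + |l|) ^ (-1 / 2)`. -/
lemma IsC1Lip.exists_norm_demodulated_sub_le {m : ℕ} (hm : 1 ≤ m)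
    {φ : EuclideanSpace ℝ (Fin m) → ℝ} (hφ : IsC1Lip 1 φ) :
    ∃ B : ℝ, 0 < B ∧ ∀ (l : ℝ) (k : Fin m → ℤ) (a : EuclideanSpace ℝ (Fin m)),
      (∀ j, |l * fderiv ℝ φ a (EuclideanSpace.single j 1) - k j| ≤ 1) →
      ∀ t, ‖demodulated l φ k t - demodulated l φ k a‖ ≤
        1 / 4 + B * (1 + |l|) * ∑ j, (1 - raisedCos (t j - a j)) := by
  obtain ⟨C, δ, hC, hδ, hT⟩ := hφ.exists_abs_sub_fderiv_le
  have hm' : (0 : ℝ) < m := by exact_mod_cast hm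
  -- `C` pays for the Taylor remainder, `m` for the linear term, `2 / δ ^ 2` for points farther than
  -- `δ`, and `π²` for passing from squared distance to `1 - raisedCos`.
  refine ⟨(C + m + 2 / δ ^ 2) * Real.pi ^ 2, by positivity, fun l k a hk t => ?_⟩
  -- Both sides are periodic in `t`, so `t` may be moved into the period cell centred at `a`.
  obtain ⟨s, hst, hs, hcos⟩ : ∃ s : EuclideanSpace ℝ (Fin m),
      demodulated l φ k s = demodulated l φ k t ∧ (∀ j, |s j - a j| ≤ Real.pi) ∧
      ∀ j, raisedCos (s j - a j) = raisedCos (t j - a j) := by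
    let z : Fin m → ℤ := fun j => toIocDiv Real.two_pi_pos (-Real.pi) (t j - a j)
    have hz : ∀ j, (t - ∑ i, z i • EuclideanSpace.single i (2 * Real.pi)) j - a j =
        (t j - a j) - z j • (2 * Real.pi) := fun j => by
      simp [WithLp.ofLp_sum, Pi.single_apply]
      ring
    refine ⟨t - ∑ j, z j • EuclideanSpace.single j (2 * Real.pi),
      ((isTorusFunction_demodulated l hφ.periodic k).periodic_sum z).sub_eq t,
      fun j => ?_, fun j => ?_⟩
    · have := sub_toIocDiv_zsmul_mem_Ioc Real.two_pi_pos (-Real.pi) (t j - a j)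
      rw [hz, abs_le]
      exact ⟨this.1.le, this.2.trans (by linarith)⟩
    · rw [hz, raisedCos_periodic.sub_zsmul_eq]
  rw [← hst]
  simp only [← hcos]
  have hnorm : ‖s - a‖ ^ 2 = ∑ j, (s j - a j) ^ 2 := by
    simp [EuclideanSpace.norm_sq_eq]
  have hsum : ‖s - a‖ ^ 2 ≤ Real.pi ^ 2 * ∑ j, (1 - raisedCos (s j - a j)) := by
    rw [hnorm, Finset.mul_sum]
    exact Finset.sum_le_sum fun j _ => sq_le_one_sub_raisedCos (hs j)
  have hmain : ‖demodulated l φ k s - demodulated l φ k a‖ ≤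
      1 / 4 + (C + m + 2 / δ ^ 2) * (1 + |l|) * ‖s - a‖ ^ 2 := by
    by_cases hd : ‖s - a‖ < δ
    · have hlin : |∑ j, (l * fderiv ℝ φ a (EuclideanSpace.single j 1) - k j) * (s j - a j)| ≤
          1 / 4 + m * ‖s - a‖ ^ 2 := by
        calc _ ≤ ∑ j, |(l * fderiv ℝ φ a (EuclideanSpace.single j 1) - k j) * (s j - a j)| :=
              Finset.abs_sum_le_sum_abs _ _
          _ ≤ ∑ j : Fin m, (1 / (4 * m) + m * (s j - a j) ^ 2) := by
              refine Finset.sum_le_sum fun j _ => ?_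
              rw [abs_mul]
              refine (mul_le_of_le_one_left (abs_nonneg _) (hk j)).trans ?_
              -- Completing the square, weighted so that the constants add up to `1/4` over the `m`
              -- coordinates.
              have : 1 / (4 * m) + m * (s j - a j) ^ 2 - |s j - a j| =
                  m * (|s j - a j| - 1 / (2 * m)) ^ 2 := by
                rw [← sq_abs (s j - a j)]
                field_simp
                ring
              have h2 : 0 ≤ m * (|s j - a j| - 1 / (2 * m)) ^ 2 := by positivity
              linarith
          _ = _ := by
              rw [Finset.sum_add_distrib, ← Finset.mul_sum, hnorm]
              simp
              field_simp
      have hphase : (l * φ s - ∑ j, (k j : ℝ) * s j) - (l * φ a - ∑ j, (k j : ℝ) * a j) =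
          l * (φ s - φ a - fderiv ℝ φ a (s - a)) +
          ∑ j, (l * fderiv ℝ φ a (EuclideanSpace.single j 1) - k j) * (s j - a j) := by
        rw [apply_eq_sum_single (fderiv ℝ φ a)]
        simp only [PiLp.sub_apply, sub_mul, mul_sub, Finset.sum_sub_distrib, Finset.mul_sum]
        simp only [mul_assoc]
        ring
      refine (norm_demodulated_sub_le l φ k s a).trans ?_
      rw [hphase]
      refine (abs_add_le _ _).trans ?_
      rw [abs_mul]
      have h1 := mul_le_mul_of_nonneg_left (hT a s hd) (abs_nonneg l)
      have h2 : 0 ≤ 2 / δ ^ 2 * (1 + |l|) * ‖s - a‖ ^ 2 := by positivity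
      have h3 : 0 ≤ C * ‖s - a‖ ^ 2 := by positivity
      have h4 : 0 ≤ m * |l| * ‖s - a‖ ^ 2 := by positivity
      nlinarith
    · have h1 : ‖demodulated l φ k s - demodulated l φ k a‖ ≤ 2 := by
        refine (norm_sub_le _ _).trans ?_
        rw [norm_demodulated, norm_demodulated]
        norm_num
      have h2 : 2 ≤ 2 / δ ^ 2 * ‖s - a‖ ^ 2 := by
        have : δ ^ 2 ≤ ‖s - a‖ ^ 2 := pow_le_pow_left₀ hδ.le (not_lt.mp hd) 2
        rw [div_mul_eq_mul_div, le_div_iff₀ (by positivity)]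
        linarith
      have h3 : 2 / δ ^ 2 * ‖s - a‖ ^ 2 ≤
          (C + m + 2 / δ ^ 2) * (1 + |l|) * ‖s - a‖ ^ 2 := by
        refine mul_le_mul_of_nonneg_right ?_ (by positivity)
        have : 0 ≤ (C + m + 2 / δ ^ 2) * |l| := by positivity
        linarith
      linarith
  refine hmain.trans ?_
  have := mul_le_mul_of_nonneg_left hsum
    (show 0 ≤ (C + m + 2 / δ ^ 2) * (1 + |l|) by positivity)
  linarith

/-- Freezing the demodulated function at `a` gives exactly the kernel mass in modulus. The error is
at most the mass times `1/4 + B(1+|l|)m/(2n+2)`, and the condition on `n` makes the second term at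
most `1/4`. -/
lemma half_le_norm_integral_demodulated_mul_cosKernel {m n : ℕ} {l B : ℝ}
    {φ : EuclideanSpace ℝ (Fin m) → ℝ} (hφ : Continuous φ) {k : Fin m → ℤ}
    {a : EuclideanSpace ℝ (Fin m)}
    (h : ∀ t, ‖demodulated l φ k t - demodulated l φ k a‖ ≤
        1 / 4 + B * (1 + |l|) * ∑ j, (1 - raisedCos (t j - a j)))
    (hn : 2 * (B * (1 + |l|) * m) ≤ n) :
    raisedCosIntegral n ^ m / 2 ≤
      ‖∫ t in cube m, demodulated l φ k t * (cosKernel n a t : ℂ)‖ := by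
  have hFc : Continuous (demodulated l φ k) := by
    unfold demodulated expPhase; fun_prop
  have hIon : ∀ {E : Type} [NormedAddCommGroup E] {g : EuclideanSpace ℝ (Fin m) → E},
      Continuous g → IntegrableOn g (cube m) := fun hg =>
    hg.continuousOn.integrableOn_compact (isCompact_cube m)
  have hsplit : ∫ t in cube m, demodulated l φ k t * (cosKernel n a t : ℂ) =
      demodulated l φ k a * ((raisedCosIntegral n ^ m : ℝ) : ℂ) +
      ∫ t in cube m, (demodulated l φ k t - demodulated l φ k a) * (cosKernel n a t : ℂ) := by
    rw [← integral_cosKernel n a, ← integral_complex_ofReal, ← integral_const_mul,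
      ← integral_add (hIon (by fun_prop)) (hIon (by fun_prop))]
    congr 1
    ext t
    ring
  have herr : ‖∫ t in cube m, (demodulated l φ k t - demodulated l φ k a) *
      (cosKernel n a t : ℂ)‖ ≤ raisedCosIntegral n ^ m / 2 := by
    calc _ ≤ ∫ t in cube m, (1 / 4 * cosKernel n a t + B * (1 + |l|) *
          ∑ j, (1 - raisedCos (t j - a j)) * cosKernel n a t) := by
          refine norm_integral_le_of_norm_le (hIon (by fun_prop)) (Filter.Eventually.of_forall
            fun t => ?_)
          rw [norm_mul, Complex.norm_real, Real.norm_of_nonneg (cosKernel_nonneg n a t)]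
          refine (mul_le_mul_of_nonneg_right (h t) (cosKernel_nonneg n a t)).trans_eq ?_
          rw [← Finset.sum_mul]
          ring
      _ = raisedCosIntegral n ^ m / 4 +
          B * (1 + |l|) * (m * (raisedCosIntegral n ^ m / (2 * n + 2))) := by
          rw [integral_add (hIon (by fun_prop)) (hIon (by fun_prop)), integral_const_mul,
            integral_const_mul, integral_finsetSum _ fun j _ => hIon (by fun_prop),
            integral_cosKernel]
          simp only [integral_one_sub_raisedCos_mul_cosKernel]
          simp
          ring
      _ ≤ _ := by
          have hw := pow_pos (raisedCosIntegral_pos n) m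
          have : B * (1 + |l|) * (m * (raisedCosIntegral n ^ m / (2 * n + 2))) =
              raisedCosIntegral n ^ m * ((B * (1 + |l|) * m) / (2 * n + 2)) := by
            field_simp
          rw [this]
          have h2 : (B * (1 + |l|) * m) / (2 * n + 2) ≤ 1 / 4 := by
            rw [div_le_div_iff₀ (by positivity) (by norm_num)]
            linarith
          nlinarith
  have hw := pow_pos (raisedCosIntegral_pos n) m
  rw [hsplit]
  have h1 := norm_sub_le_norm_add (demodulated l φ k a * ((raisedCosIntegral n ^ m : ℝ) : ℂ))
    (∫ t in cube m, (demodulated l φ k t - demodulated l φ k a) * (cosKernel n a t : ℂ))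
  rw [norm_mul, norm_demodulated, one_mul, Complex.norm_real, Real.norm_of_nonneg hw.le] at h1
  linarith

/-! ### Counting lattice cells met by a dilated set. -/

lemma volume_unit_cell {m : ℕ} (k : Fin m → ℤ) :
    volume {x : EuclideanSpace ℝ (Fin m) | ∀ j, ⌊x j⌋ = k j} = 1 := by
  have h : {x : EuclideanSpace ℝ (Fin m) | ∀ j, ⌊x j⌋ = k j} =
      (MeasurableEquiv.toLp 2 (Fin m → ℝ)).symm ⁻¹'
        Set.univ.pi (fun j => Set.Ico (k j : ℝ) (k j + 1)) := by
    ext x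
    rw [Set.mem_preimage, Set.mem_univ_pi]
    exact forall_congr' fun j => Int.floor_eq_iff
  rw [h, (EuclideanSpace.volume_preserving_symm_measurableEquiv_toLp (Fin m)).measure_preimage_equiv,
    Real.volume_pi_Ico]
  simp

/-- The number of unit cells met by a set is at least its volume. -/
lemma volume_le_encard_floor {m : ℕ} (A : Set (EuclideanSpace ℝ (Fin m))) :
    volume A ≤ (((fun x : EuclideanSpace ℝ (Fin m) => fun j => ⌊x j⌋) '' A).encard : ℝ≥0∞) := by
  set K := (fun x : EuclideanSpace ℝ (Fin m) => fun j => ⌊x j⌋) '' A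
  calc volume A ≤ volume (⋃ k ∈ K, {x : EuclideanSpace ℝ (Fin m) | ∀ j, ⌊x j⌋ = k j}) := by
        refine measure_mono fun x hx => Set.mem_biUnion (Set.mem_image_of_mem _ hx) ?_
        exact fun j => rfl
    _ ≤ ∑' k : K, volume {x : EuclideanSpace ℝ (Fin m) | ∀ j, ⌊x j⌋ = (k : Fin m → ℤ) j} :=
        measure_biUnion_le _ K.to_countable _
    _ = _ := by
        simp only [volume_unit_cell]
        rw [ENNReal.tsum_set_one]

/-- The integer points close to the dilates of a set of positive measure. -/
lemma exists_finset_floor_smul {m : ℕ} {E : Set (EuclideanSpace ℝ (Fin m))} (hE : 0 < volume E) :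
    ∃ V : ℝ, 0 < V ∧ ∀ l : ℝ, ∃ S : Finset (Fin m → ℤ), V * max 1 |l| ^ m ≤ S.card ∧
      ∀ k ∈ S, ∃ x ∈ E, ∀ j, |l * x j - k j| ≤ 1 := by
  have hV : min (volume E) 1 ≠ ⊤ := ne_top_of_le_ne_top ENNReal.one_ne_top (min_le_right _ _)
  -- Truncation at 1 keeps the constant finite and lets a single lattice point suffice when `|l| ≤
  -- 1`.
  refine ⟨(min (volume E) 1).toReal, ENNReal.toReal_pos (lt_min hE one_pos).ne' hV, fun l => ?_⟩
  set V := (min (volume E) 1).toReal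
  set K := (fun x : EuclideanSpace ℝ (Fin m) => fun j => ⌊x j⌋) '' (l • E) with hK
  have hclose : ∀ k ∈ K, ∃ x ∈ E, ∀ j, |l * x j - k j| ≤ 1 := by
    rintro _ ⟨_, ⟨x, hx, rfl⟩, rfl⟩
    refine ⟨x, hx, fun j => ?_⟩
    have h0 : (l • x) j = l * x j := rfl
    simp only [h0]
    rw [abs_le]
    constructor <;> linarith [Int.floor_le (l * x j), Int.lt_floor_add_one (l * x j)]
  -- `E` may be unbounded; if infinitely many cells are met, any sufficiently large finite subset
  -- serves.
  by_cases hfin : K.Finite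
  · refine ⟨hfin.toFinset, ?_, fun k hk => hclose k (hfin.mem_toFinset.mp hk)⟩
    have hcard : ((hfin.toFinset.card : ℕ) : ℝ≥0∞) = (K.encard : ℝ≥0∞) := by
      rw [hfin.encard_eq_coe_toFinset_card]
      rfl
    have hne : 1 ≤ hfin.toFinset.card := by
      rw [Finset.one_le_card, Set.Finite.toFinset_nonempty]
      exact ((nonempty_of_measure_ne_zero hE.ne').smul_set).image _
    rcases le_total |l| 1 with hl | hl
    · rw [max_eq_left hl, one_pow, mul_one]
      refine le_trans ?_ (Nat.one_le_cast.mpr hne)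
      exact ENNReal.toReal_le_of_le_ofReal zero_le_one (by simp)
    · rw [max_eq_right hl]
      have h1 := volume_le_encard_floor (l • E)
      rw [← hK, ← hcard, Measure.addHaar_smul, finrank_euclideanSpace_fin, abs_pow] at h1
      have h2 : ENNReal.ofReal (|l| ^ m) * min (volume E) 1 ≤ (hfin.toFinset.card : ℝ≥0∞) :=
        (mul_le_mul_right (min_le_left _ _) _).trans h1
      have h3 := ENNReal.toReal_mono (ENNReal.natCast_ne_top _) h2
      rw [ENNReal.toReal_mul, ENNReal.toReal_ofReal (by positivity), ENNReal.toReal_natCast] at h3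
      linarith
  · obtain ⟨S, hS, hcard⟩ := Set.Infinite.exists_subset_card_eq hfin ⌈V * max 1 |l| ^ m⌉₊
    refine ⟨S, ?_, fun k hk => hclose k (hS hk)⟩
    rw [hcard]
    exact Nat.le_ceil _

/-! ### Assembling the lower bound. -/

lemma gradient_apply {m : ℕ} (φ : EuclideanSpace ℝ (Fin m) → ℝ) (a : EuclideanSpace ℝ (Fin m))
    (j : Fin m) : gradient φ a j = fderiv ℝ φ a (EuclideanSpace.single j 1) := by
  rw [← toDual_gradient, InnerProductSpace.toDual_apply_apply, EuclideanSpace.inner_single_right]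
  simp

lemma rpow_neg_half_le_pow {q A M : ℝ} (hq : 0 ≤ q) (hA : 0 < A) (hM : 0 < M)
    (h : 1 ≤ A * M * q ^ 2) (m : ℕ) :
    A ^ (-((m : ℝ) / 2)) * M ^ (-((m : ℝ) / 2)) ≤ q ^ m := by
  have h1 : q ^ m = (q ^ 2) ^ ((m : ℝ) / 2) := by
    rw [← Real.rpow_natCast q 2, ← Real.rpow_mul hq, ← Real.rpow_natCast]
    congr 1
    push_cast
    ring
  rw [h1, ← Real.mul_rpow hA.le hM.le, Real.rpow_neg (by positivity), ← Real.inv_rpow (by positivity)]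
  refine Real.rpow_le_rpow (by positivity) ?_ (by positivity)
  rw [inv_le_iff_one_le_mul₀ (by positivity)]
  linarith

/-- The lower bound for the `A_p` norm of `e^{ilφ}` when the gradient of `φ` is nondegenerate. -/
theorem exists_mul_rpow_le_normA {m : ℕ} (hm : 1 ≤ m) {φ : EuclideanSpace ℝ (Fin m) → ℝ}
    (hφ : IsC1Lip 1 φ) (hgrad : NondegenerateGradient φ) {p : ℝ} (hp : 1 ≤ p) (hp2 : p < 2) :
    ∃ c : ℝ, 0 < c ∧ ∀ l ∈ frequencySet φ p,
      c * |l| ^ ((m : ℝ) * (1 / p - 1 / 2)) ≤ normA p (expPhase l φ) := by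
  obtain ⟨B, hB, hF⟩ := hφ.exists_norm_demodulated_sub_le hm
  obtain ⟨V, hV, hS⟩ := exists_finset_floor_smul hgrad
  have hp0 : 0 < p := by linarith
  set D := 2 * (B * m) with hD
  have hD0 : 0 ≤ D := by positivity
  -- Chosen so that `4n ≤ A * M`: `n ≤ D(1+|l|) + 2 ≤ 2(D+1)M`, as `1 + |l| ≤ 2M` and `M ≥ 1`.
  set A := 8 * (D + 1) with hA
  have hA0 : 0 < A := by positivity
  refine ⟨V ^ (1 / p) * (A ^ (-((m : ℝ) / 2)) / 2), by positivity, fun l hl => ?_⟩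
  obtain ⟨S, hcard, hclose⟩ := hS l
  set M := max 1 |l| with hM
  have hM1 : 1 ≤ M := le_max_left _ _
  have hM0 : 0 < M := by linarith
  have hlM : |l| ≤ M := le_max_right _ _
  -- The extra 1 guarantees `n ≥ 1`, needed for the lower bound on the kernel mass.
  set n := ⌈D * (1 + |l|)⌉₊ + 1 with hn
  have hn1 : D * (1 + |l|) ≤ n := by
    rw [hn]
    push_cast
    linarith [Nat.le_ceil (D * (1 + |l|))]
  have hn2 : 4 * (n : ℝ) ≤ A * M := by
    have h1 := Nat.ceil_lt_add_one (show 0 ≤ D * (1 + |l|) by positivity)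
    have h2 : D * (1 + |l|) ≤ D * (2 * M) := mul_le_mul_of_nonneg_left (by linarith) hD0
    rw [hn, hA]
    push_cast
    nlinarith
  set q := raisedCosIntegral n / (2 * Real.pi) with hq
  have hq0 : 0 < q := div_pos (raisedCosIntegral_pos n) (by positivity)
  have hqA : 1 ≤ A * M * q ^ 2 :=
    (one_le_mul_raisedCosIntegral_sq (Nat.le_add_left 1 _)).trans
      (mul_le_mul_of_nonneg_right hn2 (sq_nonneg _))
  have hφc := hφ.differentiable.continuous
  have hpt : ∀ k ∈ S, q ^ m / 2 ≤ ∑ w : Fin m × Fin n → Fin 4,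
      (1 / 4 ^ (m * n) : ℝ) *
        ‖fourierCoefficient (expPhase l φ) (k - cosKernelFrequency w)‖ := fun k hk => by
    obtain ⟨_, ⟨a, rfl⟩, ha⟩ := hclose k hk
    simp only [gradient_apply] at ha
    have h1 := half_le_norm_integral_demodulated_mul_cosKernel (n := n) hφc (hF l k a ha)
      (le_of_eq_of_le (by rw [hD]; ring) hn1)
    have h2 := norm_integral_mul_cosKernel_le n (f := expPhase l φ)
      (by unfold expPhase; fun_prop) k a
    have h3 := h1.trans h2
    rw [hq, div_pow, div_right_comm, div_le_iff₀ (by positivity)]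
    linarith
  have hweights : ∑ _w : Fin m × Fin n → Fin 4, (1 / 4 ^ (m * n) : ℝ) = 1 := by
    simp
  have hyoung := card_mul_rpow_le_tsum (fun _ : Fin m × Fin n → Fin 4 => (1 / 4 ^ (m * n) : ℝ))
    (fun _ => by positivity) hweights cosKernelFrequency
    (fun k => norm_nonneg (fourierCoefficient (expPhase l φ) k)) hp hl.summable S
    (c := q ^ m / 2) (by positivity) hpt
  have hqm := rpow_neg_half_le_pow hq0.le hA0 hM0 hqA m
  have hθ : 0 ≤ (m : ℝ) * (1 / p - 1 / 2) := by
    have : 1 / 2 ≤ 1 / p := one_div_le_one_div_of_le hp0 hp2.le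
    exact mul_nonneg (by positivity) (by linarith)
  calc V ^ (1 / p) * (A ^ (-((m : ℝ) / 2)) / 2) * |l| ^ ((m : ℝ) * (1 / p - 1 / 2))
      ≤ V ^ (1 / p) * (A ^ (-((m : ℝ) / 2)) / 2) * M ^ ((m : ℝ) * (1 / p - 1 / 2)) :=
        mul_le_mul_of_nonneg_left (Real.rpow_le_rpow (abs_nonneg _) hlM hθ) (by positivity)
    _ = (V * M ^ m) ^ (1 / p) * (A ^ (-((m : ℝ) / 2)) * M ^ (-((m : ℝ) / 2)) / 2) := by
        rw [Real.mul_rpow hV.le (by positivity), ← Real.rpow_natCast M m, ← Real.rpow_mul hM0.le,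
          show (m : ℝ) * (1 / p - 1 / 2) = m * (1 / p) + -((m : ℝ) / 2) by ring,
          Real.rpow_add hM0]
        ring
    _ ≤ (S.card : ℝ) ^ (1 / p) * (q ^ m / 2) := by
        refine mul_le_mul (Real.rpow_le_rpow (by positivity) hcard (by positivity))
          (by linarith) (by positivity) (by positivity)
    _ = (S.card * (q ^ m / 2) ^ p) ^ (1 / p) := by
        rw [Real.mul_rpow (by positivity) (by positivity), ← Real.rpow_mul (by positivity),
          mul_one_div_cancel hp0.ne', Real.rpow_one]
    _ ≤ normA p (expPhase l φ) := Real.rpow_le_rpow (by positivity) hyoung (by positivity)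

end TorusA

theorem corollary2 (m : ℕ) (hm : 1 ≤ m) (φ : EuclideanSpace ℝ (Fin m) → ℝ)
    (hφ : TorusA.IsC1Lip 1 φ) (hgrad : TorusA.NondegenerateGradient φ) :
    (∀ p : ℝ, 1 ≤ p → p < 2 →
      ∃ c : ℝ, 0 < c ∧ ∀ l ∈ TorusA.frequencySet φ p,
        c * |l| ^ ((m : ℝ) * (1 / p - 1 / 2)) ≤ TorusA.normA p (TorusA.expPhase l φ)) ∧
    (∃ c : ℝ, 0 < c ∧ ∀ l ∈ TorusA.frequencySet φ 1,
      c * |l| ^ ((m : ℝ) / 2) ≤ TorusA.normA 1 (TorusA.expPhase l φ)) := by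
  refine ⟨fun p hp hp2 => TorusA.exists_mul_rpow_le_normA hm hφ hgrad hp hp2, ?_⟩
  have h := TorusA.exists_mul_rpow_le_normA hm hφ hgrad le_rfl one_lt_two
  rwa [show (m : ℝ) * (1 / 1 - 1 / 2) = m / 2 by ring] at h
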